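/- A von Neumann factor is a von Neumann algebra whose center consists only of the scalar multiples of $1$. For a von Neumann algebra $N$ let $GL(N)$ be its group of invertible elements and $I(N)=\{e\in N : e^2=e\}$ its set of idempotents. For $e,f\in I(N)$ write $e\approx f$ if $eN=fN$, let $[e]$ be the equivalence class of $e$, and let $I(N)/{\approx}$ be the set of equivalence classes; the classes other than $[0]$ and $[1]$ are called nontrivial. Let $N$ and $M$ be von Neumann factors and let $\varphi\colon GL(N)\to GL(M)$ be a group isomorphism. Let $\theta\colon I(N)\to I(M)$ be the bijection induced by $\varphi$ through $1-2\theta(e)=\varphi(1-2e)$. Then there is a partition of the set of nontrivial elements of $I(N)/{\approx}$ into two (possibly empty) disjoint sets $\mathcal I_o$ and $\mathcal I_{\bar o}$ such that $$\tilde\theta([e])=\begin{cases}[\theta(e)] & \text{if } [e]\in\mathcal I_o,\\ [\theta(1-e)] & \text{if } [e]\in\mathcal I_{\bar o},\\ [1] & \text{if } e=1,\\ [0] & \text{if } e=0\end{cases}$$ is well defined (independent of the representative $e$ of the class $[e]$) and is a bijection from $I(N)/{\approx}$ onto $I(M)/{\approx}$. -/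

import Mathlib

/-- A factor: a von Neumann algebra whose center consists of the scalar multiples of `1`. -/
def VonNeumannAlgebra.IsFactor {H : Type*} [NormedAddCommGroup H] [InnerProductSpace ℂ H]
    [CompleteSpace H] (N : VonNeumannAlgebra H) : Prop :=
  ∀ z ∈ N, (∀ y ∈ N, z * y = y * z) → ∃ c : ℂ, z = c • (1 : H →L[ℂ] H)

/-- `2` is invertible in a von Neumann algebra. -/
theorem VonNeumannAlgebra.isUnit_two {H : Type*} [NormedAddCommGroup H] [InnerProductSpace ℂ H]
    [CompleteSpace H] (N : VonNeumannAlgebra H) : IsUnit (2 : N) := by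
  have hmem : ((2 : ℂ)⁻¹ • (1 : H →L[ℂ] H)) ∈ N :=
    N.toStarSubalgebra.smul_mem N.toStarSubalgebra.one_mem _
  have h2 : (((2 : N) : H →L[ℂ] H)) = (2 : ℂ) • (1 : H →L[ℂ] H) := by
    change (2 : H →L[ℂ] H) = _
    rw [two_smul, one_add_one_eq_two]
  refine ⟨⟨2, ⟨_, hmem⟩, Subtype.ext ?_, Subtype.ext ?_⟩, rfl⟩
  · change ((2 : N) : H →L[ℂ] H) * ((2 : ℂ)⁻¹ • (1 : H →L[ℂ] H)) = 1
    rw [h2, smul_mul_smul_comm]; simp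
  · change ((2 : ℂ)⁻¹ • (1 : H →L[ℂ] H)) * ((2 : N) : H →L[ℂ] H) = 1
    rw [h2, smul_mul_smul_comm]; simp

/-- The idempotents of a ring. Mathlib provides `0`, `1` and the complement `eᶜ = 1 - e` on them. -/
abbrev Idem (R : Type*) [Ring R] : Type _ := {e : R // IsIdempotentElem e}

/-- The involutions of a ring, as invertible elements: `u ^ 2 = 1`. -/
abbrev Involution (R : Type*) [Ring R] : Type _ := {u : Rˣ // u ^ 2 = 1}

/-- The principal right ideal `eR`. -/
def principalRightIdeal {R : Type*} [Ring R] (e : R) : Set R := {x | ∃ y : R, x = e * y}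

/-- `e ≈ f` means that `e` and `f` generate the same right ideal. -/
def sameRightIdeal (R : Type*) [Ring R] : Setoid (Idem R) where
  r e f := principalRightIdeal (e : R) = principalRightIdeal (f : R)
  iseqv := ⟨fun _ => rfl, fun h => h.symm, fun h k => h.trans k⟩

/-- The set of classes of idempotents up to "same right ideal". -/
abbrev IdemClass (R : Type*) [Ring R] : Type _ := Quotient (sameRightIdeal R)

/-- The class `[e]` of an idempotent. -/
def idemClass {R : Type*} [Ring R] (e : Idem R) : IdemClass R := Quotient.mk (sameRightIdeal R) e

theorem Idem.sq_one_sub_two_mul {R : Type*} [Ring R] (e : Idem R) :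
    (1 - 2 * (e : R)) * (1 - 2 * (e : R)) = 1 := by
  have h : (e : R) * (e : R) = e := e.2
  have : (1 - 2 * (e : R)) * (1 - 2 * (e : R)) = 1 - 4 * (e : R) + 4 * ((e : R) * (e : R)) := by
    noncomm_ring
  rw [this, h]; noncomm_ring

/-- The involution `1 - 2e` attached to an idempotent `e`. -/
def Idem.toInvolution {R : Type*} [Ring R] (e : Idem R) : Involution R :=
  ⟨⟨1 - 2 * (e : R), 1 - 2 * (e : R), e.sq_one_sub_two_mul, e.sq_one_sub_two_mul⟩,
    Units.ext (by rw [Units.val_pow_eq_pow_val, sq]; exact e.sq_one_sub_two_mul)⟩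

theorem Idem.toInvolution_bijective {R : Type*} [Ring R] (h2 : IsUnit (2 : R)) :
    Function.Bijective (Idem.toInvolution (R := R)) := by
  constructor
  · intro e f h
    have h' : (1 - 2 * (e : R)) = 1 - 2 * (f : R) :=
      congrArg (fun u : Involution R => ((u : Rˣ) : R)) h
    exact Subtype.ext (h2.mul_left_cancel (sub_right_injective h'))
  · rintro ⟨u, hu⟩
    obtain ⟨t, ht⟩ := h2
    have huu : (u : R) * (u : R) = 1 := by
      rw [← sq, ← Units.val_pow_eq_pow_val, hu, Units.val_one]
    obtain ⟨y, hy⟩ : ∃ y : R, 2 * y = 1 - (u : R) :=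
      ⟨(↑t⁻¹ : R) * (1 - (u : R)), by rw [← ht, Units.mul_inv_cancel_left]⟩
    have hidem : IsIdempotentElem y := by
      have h4 : (2 : R) * (2 * (y * y)) = 2 * (2 * y) := by
        have e1 : (2 : R) * (2 * (y * y)) = (2 * y) * (2 * y) := by noncomm_ring
        have e2 : (1 - (u : R)) * (1 - (u : R)) = 1 - 2 * (u : R) + (u : R) * (u : R) := by
          noncomm_ring
        rw [e1, hy, e2, huu]; noncomm_ring
      have ht2 : IsUnit (2 : R) := ⟨t, ht⟩
      exact ht2.mul_left_cancel (ht2.mul_left_cancel h4)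
    refine ⟨⟨y, hidem⟩, Subtype.ext (Units.ext ?_)⟩
    change 1 - 2 * y = (u : R)
    rw [hy, sub_sub_cancel]

/-- The bijection `e ↦ 1 - 2e` between the idempotents and the involutions of a ring in which `2`
is invertible. -/
noncomputable def Idem.equivInvolution {R : Type*} [Ring R] (h2 : IsUnit (2 : R)) :
    Idem R ≃ Involution R :=
  Equiv.ofBijective Idem.toInvolution (Idem.toInvolution_bijective h2)

/-- An isomorphism of unit groups restricts to a bijection of involutions. -/
def involutionEquiv {R S : Type*} [Ring R] [Ring S] (φ : Rˣ ≃* Sˣ) :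
    Involution R ≃ Involution S :=
  φ.toEquiv.subtypeEquiv fun u => by
    change u ^ 2 = 1 ↔ φ u ^ 2 = 1
    rw [← map_pow, EmbeddingLike.map_eq_one_iff]

/-- The bijection `θ` of idempotents induced by an isomorphism `φ` of the general linear groups of
two von Neumann algebras: `1 - 2 θ(e) = φ(1 - 2e)`. -/
noncomputable def inducedIdemEquiv {H K : Type*}
    [NormedAddCommGroup H] [InnerProductSpace ℂ H] [CompleteSpace H]
    [NormedAddCommGroup K] [InnerProductSpace ℂ K] [CompleteSpace K]
    {N : VonNeumannAlgebra H} {M : VonNeumannAlgebra K} (φ : (N : Type _)ˣ ≃* (M : Type _)ˣ) :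
    Idem N ≃ Idem M :=
  ((Idem.equivInvolution N.isUnit_two).trans (involutionEquiv φ)).trans
    (Idem.equivInvolution M.isUnit_two).symm

/-- The defining property of `θ`. -/
theorem one_sub_two_mul_inducedIdemEquiv {H K : Type*}
    [NormedAddCommGroup H] [InnerProductSpace ℂ H] [CompleteSpace H]
    [NormedAddCommGroup K] [InnerProductSpace ℂ K] [CompleteSpace K]
    {N : VonNeumannAlgebra H} {M : VonNeumannAlgebra K} (φ : (N : Type _)ˣ ≃* (M : Type _)ˣ)
    (e : Idem N) :
    1 - 2 * (inducedIdemEquiv φ e : M) = (φ (e.toInvolution : (N : Type _)ˣ) : M) := by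
  have h : (Idem.equivInvolution M.isUnit_two) (inducedIdemEquiv φ e)
      = involutionEquiv φ e.toInvolution :=
    (Idem.equivInvolution M.isUnit_two).apply_symm_apply _
  exact congrArg (fun u : Involution M => ((u : (M : Type _)ˣ) : M)) h

/-! Call two idempotents related if they generate the same right ideal or the same left ideal; the
latter means that their complements generate the same right ideal. This relation can be read off the
group of units. For `e ≠ f`, `u = 1 - 2e` and `v = 1 - 2f`, it holds exactly when `(uv)^3 ≠ 1` and
`uv` is conjugate to its square by an element of the double centralizer of `u`
(`Idem.squareConjugate_iff`, whose hard direction is `sameIdeal_or_cube_eq_one`). A factor enters as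
a prime ring in which every element is a unit up to a scalar shift.

Hence `θ` preserves the relation in both directions. Transitivity of the two equivalences then makes
`θ` carry each right class wholly into a right class or wholly into a left class. In the second case
`θ(1 - e) = 1 - θ(e)` turns left classes back into right ones. An idempotent is determined by its
right and left classes together, and a nontrivial class has at least two elements; this keeps the
images of the two kinds of class apart and gives bijectivity. -/

/-- A prime ring: `aRb = 0` only if `a = 0` or `b = 0`. -/
def PrimeRing (R : Type*) [Ring R] : Prop :=
  ∀ a b : R, (∀ y, a * y * b = 0) → a = 0 ∨ b = 0

/-! ### Products of two involutions in a prime ring -/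

/-- Let `w` be the product of the involutions of the idempotents `e` and `f`. If `w` is conjugate to
its square under a unit `g` which commutes with everything that commutes with `e`, then `e` and `f`
generate the same right ideal or the same left ideal, or else `w ^ 3 = 1`. -/
theorem sameIdeal_or_cube_eq_one {R : Type*} [Ring R] (hp : PrimeRing R)
    (h2 : IsUnit (2 : R)) (h3 : IsUnit (3 : R)) {e f g w : R}
    (he : e * e = e) (hf : f * f = f) (hu : IsUnit g)
    (hg : ∀ y, y * e = e * y → g * y = y * g)
    (hwdef : w = (1 - 2 * e) * (1 - 2 * f)) (hw : g * w = w * w * g) :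
    (e * f = f ∧ f * e = e) ∨ (e * f = e ∧ f * e = f) ∨ w * w * w = 1 := by
  obtain ⟨w', hw'⟩ : ∃ w', w' = (1 - 2 * f) * (1 - 2 * e) := ⟨_, rfl⟩
  have hue : (1 - 2 * e) * (1 - 2 * e) = 1 := by
    linear_combination (norm := noncomm_ring) 4 * he
  have huf : (1 - 2 * f) * (1 - 2 * f) = 1 := by
    linear_combination (norm := noncomm_ring) 4 * hf
  have hw'w : w' * w = 1 := by
    rw [hw', hwdef, mul_assoc, ← mul_assoc (1 - 2 * e), hue, one_mul, huf]
  have hww' : w * w' = 1 := by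
    rw [hw', hwdef, mul_assoc, ← mul_assoc (1 - 2 * f), huf, one_mul, hue]
  -- The trace `s = w + w⁻¹` commutes with `e` and `w` and acts like a scalar in the Peirce
  -- decomposition for `e` and `E = 1 - e`.
  obtain ⟨s, hs⟩ : ∃ s, s = w + w' := ⟨_, rfl⟩
  have hsw : s * w = w * s := by rw [hs, add_mul, mul_add, hw'w, hww']
  have hwwS : w * w = s * w - 1 := by rw [hs, add_mul, hw'w, add_sub_cancel_right]
  have hs4 : s = 2 - 4 * ((e - f) * (e - f)) := by
    rw [hs, hwdef, hw']
    linear_combination (norm := (noncomm_ring; simp)) 4 * he + 4 * hf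
  have hse : s * e = e * s := by
    rw [hs4]
    linear_combination (norm := noncomm_ring) 4 * (e * he) - 4 * (he * e) - 4 * (he * f)
      + 4 * (f * he) + 4 * (e * hf) - 4 * (hf * e)
  obtain ⟨E, hE⟩ : ∃ E, E = 1 - e := ⟨_, rfl⟩
  have hEE : E * E = E := by rw [hE]; linear_combination (norm := noncomm_ring) he
  have heE : e * E = 0 := by rw [hE, mul_sub, mul_one, he, sub_self]
  have hEe : E * e = 0 := by rw [hE, sub_mul, one_mul, he, sub_self]
  have hsE : s * E = E * s := by rw [hE, mul_sub, sub_mul, hse, mul_one, one_mul]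
  have hge : g * e = e * g := hg e rfl
  have hgE : g * E = E * g := hg E (by rw [hEe, heE])
  have corner : ∀ p q : R, g * p = p * g → g * q = q * g →
      g * (p * w * q) = p * (w * w) * q * g := fun p q h1 h2 => by
    calc g * (p * w * q) = (g * p) * w * q := by simp only [mul_assoc]
      _ = p * (g * w) * q := by rw [h1]; simp only [mul_assoc]
      _ = p * (w * w) * (g * q) := by rw [hw]; simp only [mul_assoc]
      _ = _ := by rw [h2]; simp only [mul_assoc]
  -- The diagonal corner `pwp` commutes with `e`, hence with `g`, so `pwp = pw²p`. With `w² = sw -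
  -- 1` and `2pwp = sp` this reads `(s² - s - 2)p = 0`.
  have quad : ∀ p : R, p * p = p → s * p = p * s → p * e = e * p → g * p = p * g →
      2 * (p * w * p) = s * p → s * s * p = s * p + 2 * p := fun p h1 h2 h3 h4 h5 => by
    have c1 := corner p p h4 h4
    have c2 : (p * w * p) * e = e * (p * w * p) := by
      have h6 : s * p * e = e * (s * p) := by
        rw [mul_assoc, h3, ← mul_assoc, hse, mul_assoc]
      rw [← h5] at h6
      apply ‹IsUnit (2 : R)›.mul_left_cancel
      linear_combination (norm := noncomm_ring) h6
    rw [hg _ c2] at c1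
    have c3 := hu.mul_right_cancel c1
    rw [hwwS] at c3
    have c4 : p * (s * w - 1) * p = s * (p * w * p) - p := by
      linear_combination (norm := noncomm_ring) - h2 * w * p - h1
    rw [c4] at c3
    linear_combination (norm := noncomm_ring) - s * h5 - 2 * c3 + h5
  have h2wqe : 2 * (e * w * e) = s * e := by
    have h1 : e * (1 - 2 * e) = -e := by linear_combination (norm := noncomm_ring) -2 * he
    have h2 : (1 - 2 * e) * e = -e := by linear_combination (norm := noncomm_ring) -2 * he
    have h3 : e * w * e = - (e * (1 - 2 * f) * e) := by
      rw [hwdef, ← mul_assoc, h1]; noncomm_ring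
    have h4 : e * w' * e = - (e * (1 - 2 * f) * e) := by
      rw [hw', mul_assoc, mul_assoc, h2]; noncomm_ring
    have h5 : s * e = e * s * e := by rw [← hse, mul_assoc, he]
    rw [h5, hs, mul_add, add_mul, h4, h3, two_mul]
  have qe : s * s * e = s * e + 2 * e := quad e he hse rfl hge h2wqe
  have h2wqE : 2 * (E * w * E) = s * E := by
    have h1 : E * (1 - 2 * e) = E := by linear_combination (norm := noncomm_ring) -2 * hEe
    have h2 : (1 - 2 * e) * E = E := by linear_combination (norm := noncomm_ring) -2 * heE
    have h3 : E * w * E = E * (1 - 2 * f) * E := by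
      rw [hwdef, ← mul_assoc, h1]
    have h4 : E * w' * E = E * (1 - 2 * f) * E := by
      rw [hw', mul_assoc, mul_assoc, h2, mul_assoc]
    have h5 : s * E = E * s * E := by rw [← hsE, mul_assoc, hEE]
    rw [h5, hs, mul_add, add_mul, h4, h3, two_mul]
  have qE : s * s * E = s * E + 2 * E := quad E hEE hsE (by rw [heE, hEe]) hgE h2wqE
  have hss : s * s = s + 2 := by
    rw [hE] at qE
    linear_combination (norm := (noncomm_ring; simp)) qe + qE
  obtain ⟨b, hb⟩ : ∃ b, b = e * w * E := ⟨_, rfl⟩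
  obtain ⟨c, hc⟩ : ∃ c, c = E * w * e := ⟨_, rfl⟩
  have hgb : g * b = s * b * g := by
    rw [hb, corner e E hge hgE, hwwS]
    linear_combination (norm := noncomm_ring) - hse * w * E * g - heE * g
  have hgc : g * c = s * c * g := by
    rw [hc, corner E e hgE hge, hwwS]
    linear_combination (norm := noncomm_ring) - hsE * w * e * g - hEe * g
  have heb : e * b = b := by rw [hb]; linear_combination (norm := noncomm_ring) he * w * E
  have hbE : b * E = b := by rw [hb]; linear_combination (norm := noncomm_ring) e * w * hEE
  have hEc : E * c = c := by rw [hc]; linear_combination (norm := noncomm_ring) hEE * w * e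
  have hce : c * e = c := by rw [hc]; linear_combination (norm := noncomm_ring) E * w * he
  have hsc : s * c = c * s := by
    rw [hc]; linear_combination (norm := noncomm_ring) hsE * w * e + E * hsw * e + E * w * hse
  -- Both `EzE` and `bzc` commute with `e`, hence with `g`, while moving `g` past `b` or `c` costs a
  -- factor `s`.
  have key : ∀ z, b * z * c = s * b * z * s * c := fun z => by
    have hy : g * (E * z * E) = E * z * E * g := hg _ (by
      rw [mul_assoc _ E e, hEe, ← mul_assoc e, ← mul_assoc e, heE, mul_zero, zero_mul,
        zero_mul])
    have hbc : g * (b * z * c) = b * z * c * g := hg _ (by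
      rw [mul_assoc _ c e, hce, ← mul_assoc e, ← mul_assoc e, heb])
    apply hu.mul_right_cancel
    rw [← hbc]
    calc g * (b * z * c) = g * ((b * E) * z * (E * c)) := by rw [hbE, hEc]
      _ = (g * b) * (E * z * E) * c := by simp only [mul_assoc]
      _ = s * b * (g * (E * z * E)) * c := by rw [hgb]; simp only [mul_assoc]
      _ = s * b * (E * z * E) * (g * c) := by rw [hy]; simp only [mul_assoc]
      _ = s * (b * E) * z * (E * s) * c * g := by rw [hgc]; simp only [mul_assoc]
      _ = s * (b * E) * z * s * (E * c) * g := by rw [← hsE]; simp only [mul_assoc]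
      _ = _ := by rw [hbE, hEc]
  -- Since `s² = s + 2`, the square of `1 - 2s` is `9`, a unit; so in `hA` and `hB` the factor `1 -
  -- 2s` can be cancelled.
  have hinv : (1 - 2 * s) * (1 - 2 * s) = 3 * 3 := by
    linear_combination (norm := (noncomm_ring; simp; norm_num)) 4 * hss
  have cancel : ∀ x, (1 - 2 * s) * x = 0 → x = 0 := fun x hx => by
    have : (3 * 3) * x = 0 := by rw [← hinv, mul_assoc, hx, mul_zero]
    exact (h3.mul h3).mul_right_eq_zero.1 this
  have hA := hp ((s + 1) * b) ((1 - 2 * s) * c) fun z => by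
    linear_combination (norm := noncomm_ring) (s + 1) * key z + hss * b * z * s * c
  have hB := hp ((1 - 2 * s) * b) (c * (s + 1)) fun z => by
    linear_combination (norm := noncomm_ring) key z * (s + 1) + s * b * z * hsc * (s + 1)
      + s * b * z * c * hss
  have h30 : ∀ x : R, x * x = x → 3 * x = 4 * (x * x) → x = 0 := fun x h1 h2 => by
    rw [h1] at h2
    linear_combination (norm := noncomm_ring) - h2
  -- With `k = (e - f)²` and `s = 2 - 4k`, the equation `s² = s + 2` becomes `3k = 4k²`; an
  -- idempotent `x` of the form `kp` then has `3x = 4x`, so it vanishes.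
  have hk : 3 * ((e - f) * (e - f)) = 4 * (((e - f) * (e - f)) * ((e - f) * (e - f))) := by
    apply (h2.mul h2).mul_left_cancel
    have := hss
    rw [hs4] at this
    linear_combination (norm := noncomm_ring) - this
  obtain ⟨k, hkd⟩ : ∃ k, k = (e - f) * (e - f) := ⟨_, rfl⟩
  rw [← hkd] at hk hs4
  have hke : k * e = e - e * f * e := by
    rw [hkd]; linear_combination (norm := noncomm_ring) e * he + he - f * he + hf * e
  have hek : e * k = e - e * f * e := by
    rw [hkd]; linear_combination (norm := noncomm_ring) e * he + he - he * f + e * hf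
  have hkE : k * E = f - e * f - f * e + e * f * e := by
    rw [hE, mul_sub, mul_one, hke, hkd]
    linear_combination (norm := noncomm_ring) he + hf
  have hzero : ∀ x p, x = k * p → k * p = p * k → p * p = p → x * x = x → x = 0 :=
    fun x p h1 h2 h3 h4 => by
      apply h30 x h4
      rw [h1]
      linear_combination (norm := noncomm_ring) hk * p + 4 * (k * h2 * p) - 4 * (k * k * h3)
  have hkE' : k * E = E * k := by rw [hE, mul_sub, sub_mul, mul_one, one_mul, hke, hek]
  have hke' : k * e = e * k := hke.trans hek.symm
  -- Here `fe = efe`, which makes `ke = e - fe` and `kE = f - ef` idempotent, hence zero.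
  have caseC : c = 0 → e * f = f ∧ f * e = e := fun h0 => by
    have hfe : f * e = e * f * e := by
      apply h2.mul_left_cancel
      rw [hc, hE, hwdef] at h0
      linear_combination (norm := noncomm_ring) - h0 - he + 2 * he * e - 4 * he * f * e
    have hfefe : f * e * f * e = f * e := by
      linear_combination (norm := noncomm_ring) - f * hfe + hf * e
    have x1 : e - f * e = 0 := hzero _ e (by rw [hke, ← hfe]) hke' he (by
      linear_combination (norm := noncomm_ring) he + hfe - f * he + hfefe)
    have x2 : f - e * f = 0 := hzero _ E (by rw [hkE, ← hfe]; abel) hkE' hEE (by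
      linear_combination (norm := noncomm_ring) hf - hfe * f - e * hf)
    exact ⟨(sub_eq_zero.1 x2).symm, (sub_eq_zero.1 x1).symm⟩
  have caseB : b = 0 → e * f = e ∧ f * e = f := fun h0 => by
    have hfe : e * f = e * f * e := by
      apply h2.mul_left_cancel
      rw [hb, hE, hwdef] at h0
      linear_combination (norm := noncomm_ring) h0 - 4 * he * f + 4 * he * f * e - 2 * he * e + he
    have hfefe : e * f * e * f = e * f := by
      linear_combination (norm := noncomm_ring) - hfe * f + e * hf
    have x1 : e - e * f = 0 := hzero _ e (by rw [hke, ← hfe]) hke' he (by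
      linear_combination (norm := noncomm_ring) he + hfe - he * f + hfefe)
    have x2 : f - f * e = 0 := hzero _ E (by rw [hkE, ← hfe]; abel) hkE' hEE (by
      linear_combination (norm := noncomm_ring) hf - hf * e - f * hfe)
    exact ⟨(sub_eq_zero.1 x1).symm, (sub_eq_zero.1 x2).symm⟩
  rcases hB with hB | hB
  · exact Or.inr (Or.inl (caseB (cancel _ hB)))
  rcases hA with hA | hA
  swap
  · exact Or.inl (caseC (cancel _ hA))
  refine Or.inr (Or.inr ?_)
  have hw2 : 2 * w = s + 2 * b + 2 * c := by
    rw [hE] at h2wqE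
    rw [hb, hc, hE]
    linear_combination (norm := noncomm_ring) h2wqe + h2wqE
  -- Now `s + 1` kills both off-diagonal corners, and `(s + 1)(s - 2) = 0` handles the diagonal. As
  -- `w² + w + 1 = (s + 1)w`, this gives `w³ = 1`.
  have : (s + 1) * (w - 1) = 0 := by
    apply h2.mul_left_cancel
    linear_combination (norm := (noncomm_ring; simp)) (s + 1) * hw2 + 2 * hA + 2 * hB + 2 * hsc + hss
  linear_combination (norm := noncomm_ring) w * hwwS - hsw * w + s * hwwS + hss * w + this

/-! ### Factors are prime and rich in units -/

theorem VonNeumannAlgebra.IsFactor.primeRing {H : Type*} [NormedAddCommGroup H]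
    [InnerProductSpace ℂ H] [CompleteSpace H] {N : VonNeumannAlgebra H} (hN : N.IsFactor) :
    PrimeRing N := by
  intro a b hab
  by_contra! hne
  obtain ⟨ha, hb⟩ := hne
  -- The common kernel of all `ay` is invariant under `N` and its commutant, so its projection is
  -- central and therefore scalar. It contains the range of `b ≠ 0`, so it is everything and `a =
  -- 0`.
  let S : Submodule ℂ H := ⨅ y : N, ((a : H →L[ℂ] H) * (y : H →L[ℂ] H)).ker
  have hS : ∀ v, v ∈ S ↔ ∀ y : N, (a : H →L[ℂ] H) ((y : H →L[ℂ] H) v) = 0 := fun v => by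
    simp [S]
  have hclosed : IsClosed (S : Set H) := by
    simp only [S, Submodule.coe_iInf]
    exact isClosed_iInter fun y => ContinuousLinearMap.isClosed_ker _
  have : CompleteSpace S := hclosed.completeSpace_coe
  have hp : IsStarProjection S.starProjection := isStarProjection_starProjection
  have hrange : S.starProjection.range = S := Submodule.range_starProjection S
  have hmem : S.starProjection ∈ N := by
    rw [VonNeumannAlgebra.IsStarProjection.mem_iff hp]
    intro t ht
    rw [hrange]
    intro v hv
    change t v ∈ S
    rw [hS] at hv ⊢
    intro y
    have h1 := (VonNeumannAlgebra.mem_commutant_iff.1 ht) _ (a * y).2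
    have h2 := congrArg (fun T : H →L[ℂ] H => T v) h1
    change (a : H →L[ℂ] H) ((y : H →L[ℂ] H) (t v)) = t ((a : H →L[ℂ] H) ((y : H →L[ℂ] H) v))
      at h2
    rw [h2, hv, map_zero]
  have hmem' : S.starProjection ∈ N.commutant := by
    rw [VonNeumannAlgebra.IsStarProjection.mem_iff hp, VonNeumannAlgebra.commutant_commutant]
    intro t ht
    rw [hrange]
    intro v hv
    change t v ∈ S
    rw [hS] at hv ⊢
    intro y
    exact hv (y * ⟨t, ht⟩)
  obtain ⟨c, hc⟩ := hN _ hmem fun y hy =>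
    ((VonNeumannAlgebra.mem_commutant_iff.1 hmem') y hy).symm
  have hbne : (b : H →L[ℂ] H) ≠ 0 := fun h => hb (Subtype.ext h)
  obtain ⟨v, hv⟩ : ∃ v, (b : H →L[ℂ] H) v ≠ 0 := by
    by_contra! h
    exact hbne (ContinuousLinearMap.ext h)
  have hbv : (b : H →L[ℂ] H) v ∈ S := (hS _).2 fun y =>
    congrArg (fun T : N => (T : H →L[ℂ] H) v) (hab y)
  have hfix := Submodule.starProjection_eq_self_iff.2 hbv
  have hc1 : c = 1 := by
    rw [hc] at hfix
    have : (c - 1) • (b : H →L[ℂ] H) v = 0 := by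
      rw [sub_smul, one_smul, sub_eq_zero]; exact hfix
    exact sub_eq_zero.1 ((smul_eq_zero.1 this).resolve_right hv)
  refine ha (Subtype.ext (ContinuousLinearMap.ext fun x => ?_))
  have hx : x ∈ S := Submodule.starProjection_eq_self_iff.1 (by rw [hc, hc1, one_smul]; rfl)
  exact (hS x).1 hx 1

/-- The inverse commutes with whatever the element commutes with, so it lies in the bicommutant. -/
theorem VonNeumannAlgebra.isUnit_of_coe {H : Type*} [NormedAddCommGroup H]
    [InnerProductSpace ℂ H] [CompleteSpace H] (N : VonNeumannAlgebra H) {y : N}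
    (hy : IsUnit (y : H →L[ℂ] H)) : IsUnit y := by
  obtain ⟨u, hu⟩ := hy
  have hmem : ((u⁻¹ : (H →L[ℂ] H)ˣ) : H →L[ℂ] H) ∈ N := by
    rw [← N.commutant_commutant, VonNeumannAlgebra.mem_commutant_iff]
    intro t ht
    have h : Commute t (u : H →L[ℂ] H) := by
      rw [hu]
      exact ((VonNeumannAlgebra.mem_commutant_iff.1 ht) _ y.2).symm
    exact h.units_inv_right
  refine ⟨⟨y, ⟨_, hmem⟩, Subtype.ext ?_, Subtype.ext ?_⟩, rfl⟩
  · change (y : H →L[ℂ] H) * ((u⁻¹ : (H →L[ℂ] H)ˣ) : H →L[ℂ] H) = 1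
    rw [← hu, u.mul_inv]
  · change ((u⁻¹ : (H →L[ℂ] H)ˣ) : H →L[ℂ] H) * (y : H →L[ℂ] H) = 1
    rw [← hu, u.inv_mul]

/-- Every element of the ring becomes invertible after adding a suitable central element. -/
def UnitAbundant (R : Type*) [Ring R] : Prop :=
  ∀ y : R, ∃ c : R, (∀ x, c * x = x * c) ∧ IsUnit (y + c)

theorem VonNeumannAlgebra.smul_one_mem {H : Type*} [NormedAddCommGroup H]
    [InnerProductSpace ℂ H] [CompleteSpace H] (N : VonNeumannAlgebra H) (k : ℂ) :
    k • (1 : H →L[ℂ] H) ∈ N :=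
  N.toStarSubalgebra.smul_mem N.toStarSubalgebra.one_mem k

theorem VonNeumannAlgebra.unitAbundant {H : Type*} [NormedAddCommGroup H]
    [InnerProductSpace ℂ H] [CompleteSpace H] (N : VonNeumannAlgebra H) : UnitAbundant N := by
  intro y
  obtain ⟨k, hk⟩ : ∃ k : ℂ, ‖(y : H →L[ℂ] H)‖ * ‖(1 : H →L[ℂ] H)‖ < ‖k‖ :=
    NormedField.exists_lt_norm ℂ _
  have hu : IsUnit (algebraMap ℂ (H →L[ℂ] H) k - y) := spectrum.mem_resolventSet_of_norm_lt_mul hk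
  refine ⟨⟨(-k) • (1 : H →L[ℂ] H), N.smul_one_mem _⟩, fun x => Subtype.ext ?_, ?_⟩
  · change (-k) • (1 : H →L[ℂ] H) * (x : H →L[ℂ] H) = (x : H →L[ℂ] H) * (-k) • (1 : H →L[ℂ] H)
    rw [smul_mul_assoc, mul_smul_comm, one_mul, mul_one]
  · apply N.isUnit_of_coe
    have : (y : H →L[ℂ] H) + (-k) • (1 : H →L[ℂ] H) = -(algebraMap ℂ (H →L[ℂ] H) k - y) := by
      rw [Algebra.algebraMap_eq_smul_one, neg_smul]; abel
    change IsUnit ((y : H →L[ℂ] H) + (-k) • (1 : H →L[ℂ] H))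
    rw [this]
    exact hu.neg

theorem VonNeumannAlgebra.isUnit_three {H : Type*} [NormedAddCommGroup H]
    [InnerProductSpace ℂ H] [CompleteSpace H] (N : VonNeumannAlgebra H) : IsUnit (3 : N) := by
  apply N.isUnit_of_coe
  have h3 : IsUnit (3 : ℂ) := isUnit_iff_ne_zero.2 (by norm_num)
  have := h3.map (algebraMap ℂ (H →L[ℂ] H))
  rwa [map_ofNat] at this

/-! ### Right and left classes of idempotents -/

theorem idemClass_eq_iff {R : Type*} [Ring R] {e f : Idem R} :
    idemClass e = idemClass f ↔ (e : R) * f = f ∧ (f : R) * e = e := by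
  have hf : (f : R) * f = f := f.2
  have he : (e : R) * e = e := e.2
  rw [idemClass, idemClass, Quotient.eq]
  change principalRightIdeal (e : R) = principalRightIdeal (f : R) ↔ _
  constructor
  · intro h
    have h1 : (f : R) ∈ principalRightIdeal (e : R) := h ▸ ⟨f, hf.symm⟩
    have h2 : (e : R) ∈ principalRightIdeal (f : R) := h ▸ ⟨e, he.symm⟩
    obtain ⟨x, hx⟩ := h1
    obtain ⟨y, hy⟩ := h2
    constructor
    · conv_lhs => rw [hx]
      rw [← mul_assoc, he, ← hx]
    · conv_lhs => rw [hy]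
      rw [← mul_assoc, hf, ← hy]
  · rintro ⟨h1, h2⟩
    ext x
    constructor
    · rintro ⟨y, rfl⟩
      exact ⟨e * y, by rw [← mul_assoc, h2]⟩
    · rintro ⟨y, rfl⟩
      exact ⟨f * y, by rw [← mul_assoc, h1]⟩

/-- Passing to complements exchanges right ideals for left ideals: the right-hand side says `Re =
Rf`. -/
theorem idemClass_compl_eq_iff {R : Type*} [Ring R] {e f : Idem R} :
    idemClass eᶜ = idemClass fᶜ ↔ (e : R) * f = e ∧ (f : R) * e = f := by
  rw [idemClass_eq_iff, IsIdempotentElem.coe_compl, IsIdempotentElem.coe_compl]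
  refine and_congr ⟨fun h => ?_, fun h => ?_⟩ ⟨fun h => ?_, fun h => ?_⟩
  · linear_combination (norm := noncomm_ring) h
  · linear_combination (norm := noncomm_ring) h
  · linear_combination (norm := noncomm_ring) h
  · linear_combination (norm := noncomm_ring) h

theorem Idem.compl_compl_eq {R : Type*} [Ring R] (e : Idem R) : eᶜᶜ = e :=
  Subtype.ext (sub_sub_cancel _ _)

theorem Idem.eq_of_idemClass_eq {R : Type*} [Ring R] {e f : Idem R}
    (h : idemClass e = idemClass f) (h' : idemClass eᶜ = idemClass fᶜ) : e = f :=
  Subtype.ext ((idemClass_eq_iff.1 h).2.symm.trans (idemClass_compl_eq_iff.1 h').2)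

/-- In a prime ring, an idempotent which is alone in its class is trivial. -/
theorem PrimeRing.eq_zero_or_one_of_class_subsingleton {R : Type*} [Ring R] (hp : PrimeRing R)
    (e : Idem R) (h : ∀ f : Idem R, idemClass e = idemClass f → e = f) : e = 0 ∨ e = 1 := by
  have he : (e : R) * e = e := e.2
  have key : ∀ y : R, (e : R) * y * (1 - e) = 0 := fun y => by
    -- Each `e + ey(1 - e)` lies in the class of `e`, so a singleton class forces `eR(1 - e) = 0`.
    have hid : IsIdempotentElem ((e : R) + e * y * (1 - e)) := by
      change _ * _ = _
      linear_combination (norm := noncomm_ring)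
        he + he * y - he * y * (e : R) - (e : R) * y * he - (e : R) * y * he * y
        + (e : R) * y * he * y * (e : R)
    have h1 : e = ⟨_, hid⟩ := h ⟨_, hid⟩ (idemClass_eq_iff.2 ⟨by
      change (e : R) * ((e : R) + e * y * (1 - e)) = (e : R) + e * y * (1 - e)
      linear_combination (norm := noncomm_ring) he + he * y - he * y * (e : R), by
      change ((e : R) + e * y * (1 - e)) * (e : R) = (e : R)
      linear_combination (norm := noncomm_ring) he - (e : R) * y * he⟩)
    have h2 : (e : R) = (e : R) + e * y * (1 - e) := congrArg Subtype.val h1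
    exact left_eq_add.1 h2
  rcases hp (e : R) (1 - e) key with h0 | h1
  · exact Or.inl (Subtype.ext h0)
  · exact Or.inr (Subtype.ext (sub_eq_zero.1 h1).symm)

/-! ### Group-theoretic detection of the relation -/

/-- The product of `u` and `v` is not of order dividing `3` and is conjugate to its square by an
element of the double centralizer of `u`. -/
def SquareConjugate {G : Type*} [Group G] (u v : G) : Prop :=
  (u * v) ^ 3 ≠ 1 ∧
    ∃ g : G, (∀ h : G, h * u = u * h → g * h = h * g) ∧ g * (u * v) = (u * v) ^ 2 * g

theorem SquareConjugate.map {G G' : Type*} [Group G] [Group G'] (φ : G ≃* G') {u v : G}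
    (h : SquareConjugate u v) : SquareConjugate (φ u) (φ v) := by
  obtain ⟨h3, g, hg, hw⟩ := h
  refine ⟨?_, φ g, fun k hk => ?_, ?_⟩
  · rwa [← map_mul, ← map_pow, Ne, EmbeddingLike.map_eq_one_iff]
  · obtain ⟨k, rfl⟩ := φ.surjective k
    rw [← map_mul, ← map_mul] at hk ⊢
    rw [hg k (φ.injective hk)]
  · rw [← map_mul, ← map_pow, ← map_mul, ← map_mul, hw]

theorem squareConjugate_map_iff {G G' : Type*} [Group G] [Group G'] (φ : G ≃* G') {u v : G} :
    SquareConjugate (φ u) (φ v) ↔ SquareConjugate u v :=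
  ⟨fun h => by simpa using h.map φ.symm, fun h => h.map φ⟩

theorem Idem.squareConjugate_iff {R : Type*} [Ring R] (hp : PrimeRing R) (ha : UnitAbundant R)
    (h2 : IsUnit (2 : R)) (h3 : IsUnit (3 : R)) {e f : Idem R} (hne : e ≠ f) :
    SquareConjugate (e.toInvolution : Rˣ) (f.toInvolution : Rˣ) ↔
      idemClass e = idemClass f ∨ idemClass eᶜ = idemClass fᶜ := by
  have he : (e : R) * e = e := e.2
  have hf : (f : R) * f = f := f.2
  have hue : ((e.toInvolution : Rˣ) : R) = 1 - 2 * (e : R) := rfl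
  have huf : ((f.toInvolution : Rˣ) : R) = 1 - 2 * (f : R) := rfl
  rw [idemClass_eq_iff, idemClass_compl_eq_iff]
  constructor
  · rintro ⟨h, g, hg, hw⟩
    have key := sameIdeal_or_cube_eq_one hp h2 h3 he hf g.isUnit (fun y hy => ?_) rfl (by
      have := congrArg Units.val hw
      rw [sq] at this
      simpa only [Units.val_mul, hue, huf] using this)
    · rcases key with h1 | h1 | h1
      · exact Or.inl h1
      · exact Or.inr h1
      · refine absurd (Units.ext ?_) h
        rw [pow_succ, sq]
        simpa only [Units.val_mul, hue, huf, Units.val_one] using h1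
    -- A central shift of `y` is a unit, which transfers the double centralizer condition from units
    -- to all ring elements.
    · obtain ⟨c, hc, k, hk⟩ := ha y
      have h1 := congrArg Units.val (hg k (Units.ext (by
        rw [Units.val_mul, Units.val_mul, hue, hk]
        linear_combination (norm := noncomm_ring) -2 * hy - 2 * hc e)))
      rw [Units.val_mul, Units.val_mul, hk] at h1
      linear_combination (norm := noncomm_ring) h1 + hc g
  · have hunit : ∀ a b : R, a * b = 2 → b * a = 2 → IsUnit a := fun a b hab hba =>
      ((Commute.isUnit_mul_iff (hab.trans hba.symm)).1 (hab ▸ h2)).1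
    have build : ∀ g n : R, IsUnit g → (∀ y, y * (e : R) = e * y → g * y = y * g) →
        (1 - 2 * (e : R)) * (1 - 2 * (f : R)) = 1 + 2 * n → n * n = 0 → n ≠ 0 →
        g * n = 2 * n * g → SquareConjugate (e.toInvolution : Rˣ) (f.toInvolution : Rˣ) := by
      rintro _ n ⟨g, rfl⟩ hg hw hnn hn0 hgn
      have hw' : (((e.toInvolution : Rˣ) * (f.toInvolution : Rˣ) : Rˣ) : R) = 1 + 2 * n := by
        rw [Units.val_mul, hue, huf, hw]
      refine ⟨fun h => hn0 ?_, g, fun y hy => Units.ext ?_, Units.ext ?_⟩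
      -- As `n² = 0`, the equation `(1 + 2n)³ = 1` reduces to `6n = 0`.
      · have h1 := congrArg Units.val h
        rw [Units.val_pow_eq_pow_val, hw', Units.val_one, pow_succ, sq] at h1
        apply (h2.mul h3).mul_right_eq_zero.1
        linear_combination (norm := noncomm_ring) h1 - 12 * hnn - 8 * n * hnn
      · rw [Units.val_mul, Units.val_mul]
        apply hg
        apply h2.mul_left_cancel
        have h1 := congrArg Units.val hy
        rw [Units.val_mul, Units.val_mul, hue] at h1
        linear_combination (norm := noncomm_ring) -h1
      · rw [Units.val_mul g, Units.val_mul _ g, Units.val_pow_eq_pow_val, hw', sq]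
        linear_combination (norm := noncomm_ring) 2 * hgn - 4 * hnn * (g : R)
    rintro (⟨h1, h4⟩ | ⟨h1, h4⟩)
    -- Here `n ∈ eR(1 - e)`, and `1 + e` acts as `2` on `eR` and as `1` on `(1 - e)R`, so
    -- conjugation doubles `n`. In the other case `n ∈ (1 - e)Re` and `2 - e` swaps the two scalars.
    -- Invertibility comes from `(1 + e)(2 - e) = 2`.
    · refine build (1 + e) (f - e) (hunit _ (2 - e) ?_ ?_) (fun y hy => ?_) ?_ ?_ ?_ ?_
      · linear_combination (norm := (noncomm_ring; simp)) -he
      · linear_combination (norm := noncomm_ring) -he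
      · linear_combination (norm := noncomm_ring) -hy
      · linear_combination (norm := noncomm_ring) 4 * h1
      · linear_combination (norm := noncomm_ring) hf - h4 - h1 + he
      · exact fun h => hne (Subtype.ext (sub_eq_zero.1 h).symm)
      · linear_combination (norm := noncomm_ring) h1 + he - 2 * h4
    · refine build (2 - e) (e - f) (hunit _ (1 + e) ?_ ?_) (fun y hy => ?_) ?_ ?_ ?_ ?_
      · linear_combination (norm := noncomm_ring) -he
      · linear_combination (norm := (noncomm_ring; simp)) -he
      · linear_combination (norm := noncomm_ring) hy
      · linear_combination (norm := noncomm_ring) 4 * h1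
      · linear_combination (norm := noncomm_ring) hf - h4 - h1 + he
      · exact fun h => hne (Subtype.ext (sub_eq_zero.1 h))
      · linear_combination (norm := noncomm_ring) h1 + he - 2 * h4

/-! ### From a relation-preserving bijection to a bijection of classes -/

section ClassMap

variable {R S : Type*} [Ring R] [Ring S]

/-- A map of idempotents preserves the class of `e`. -/
def PreservesClass (θ : Idem R → Idem S) (e : Idem R) : Prop :=
  ∀ f, idemClass e = idemClass f → idemClass (θ e) = idemClass (θ f)

/-- If `θ` respects the relation "same right ideal or same left ideal", then it carries each class
into a class of right ideals or into a class of left ideals. -/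
theorem idemClass_compl_eq_of_not_preservesClass {θ : Idem R → Idem S}
    (hD : ∀ e f, idemClass e = idemClass f ∨ idemClass eᶜ = idemClass fᶜ →
      idemClass (θ e) = idemClass (θ f) ∨ idemClass (θ e)ᶜ = idemClass (θ f)ᶜ)
    {e : Idem R} (he : ¬ PreservesClass θ e) {g : Idem R} (hg : idemClass e = idemClass g) :
    idemClass (θ e)ᶜ = idemClass (θ g)ᶜ := by
  simp only [PreservesClass, not_forall] at he
  obtain ⟨f, hef, hf⟩ := he
  have hf' := (hD e f (Or.inl hef)).resolve_left hf
  -- If `θ g` is right equivalent to `θ e`, it cannot be so to `θ f`; left equivalence then passes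
  -- from `θ e` through `θ f` to `θ g`.
  rcases hD e g (Or.inl hg) with h | h
  · rcases hD f g (Or.inl (hef.symm.trans hg)) with h' | h'
    · exact absurd (h.trans h'.symm) hf
    · exact hf'.trans h'
  · exact h

theorem PreservesClass.congr {θ : Idem R → Idem S} {e f : Idem R} (h : PreservesClass θ e)
    (hef : idemClass e = idemClass f) : PreservesClass θ f :=
  fun _ hg => (h f hef).symm.trans (h _ (hef.trans hg))

theorem idemClass_eq_zero_iff {e : Idem R} : idemClass e = idemClass 0 ↔ e = 0 := by
  refine ⟨fun h => Subtype.ext ?_, fun h => by rw [h]⟩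
  exact (idemClass_eq_iff.1 h).2.symm.trans (zero_mul (e : R))

theorem idemClass_eq_one_iff {e : Idem R} : idemClass e = idemClass 1 ↔ e = 1 := by
  refine ⟨fun h => Subtype.ext ?_, fun h => by rw [h]⟩
  exact (mul_one (e : R)).symm.trans (idemClass_eq_iff.1 h).1

/-- A second member `e'` of the class of `e` would be related to `g`: on the right this gives `e =
g`, on the left `e' = e`. A singleton class is trivial and is settled directly. -/
theorem PreservesClass.eq_of_idemClass_compl_eq {θ : Idem R → Idem S}
    (hD : ∀ e f, idemClass (θ e) = idemClass (θ f) ∨ idemClass (θ e)ᶜ = idemClass (θ f)ᶜ →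
      idemClass e = idemClass f ∨ idemClass eᶜ = idemClass fᶜ)
    (hsub : ∀ e : Idem R, (∀ f : Idem R, idemClass e = idemClass f → e = f) → e = 0 ∨ e = 1)
    {e g : Idem R} (he : PreservesClass θ e) (hL : idemClass eᶜ = idemClass gᶜ)
    (hR : idemClass (θ e) = idemClass (θ g)) : e = g := by
  by_cases hex : ∀ e', idemClass e = idemClass e' → e = e'
  · have h2 : eᶜ = gᶜ := by
      rcases hsub e hex with rfl | rfl
      · have h1 : (0 : Idem R)ᶜ = 1 := Subtype.ext (sub_zero _)
        rw [h1] at hL ⊢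
        exact (idemClass_eq_one_iff.1 hL.symm).symm
      · have h1 : (1 : Idem R)ᶜ = 0 := Subtype.ext (sub_self _)
        rw [h1] at hL ⊢
        exact (idemClass_eq_zero_iff.1 hL.symm).symm
    rw [← e.compl_compl_eq, h2, g.compl_compl_eq]
  · push Not at hex
    obtain ⟨e', h1, h2⟩ := hex
    rcases hD e' g (Or.inl ((he e' h1).symm.trans hR)) with h3 | h3
    · exact Idem.eq_of_idemClass_eq (h1.trans h3) hL
    · exact absurd (Idem.eq_of_idemClass_eq h1 (hL.trans h3.symm)) h2

/-- Preserved and reversed classes have different images. -/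
theorem PreservesClass.idemClass_ne_compl {θ : Idem R ≃ Idem S}
    (hD : ∀ e f, idemClass e = idemClass f ∨ idemClass eᶜ = idemClass fᶜ ↔
      idemClass (θ e) = idemClass (θ f) ∨ idemClass (θ e)ᶜ = idemClass (θ f)ᶜ)
    (hc : ∀ e, θ eᶜ = (θ e)ᶜ)
    (hsub : ∀ e : Idem R, (∀ f : Idem R, idemClass e = idemClass f → e = f) → e = 0 ∨ e = 1)
    {e f : Idem R} (he : PreservesClass θ e) (hf : ¬ PreservesClass θ f) :
    idemClass (θ e) ≠ idemClass (θ fᶜ) := by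
  intro h
  have alone : ∀ g, idemClass eᶜ = idemClass gᶜ → idemClass (θ e) = idemClass (θ g) →
      e = g := fun g => he.eq_of_idemClass_compl_eq (fun e f => (hD e f).2) hsub
  have hf' := hf
  simp only [PreservesClass, not_forall] at hf'
  obtain ⟨f₁, hf₁, hne⟩ := hf'
  have hflip := idemClass_compl_eq_of_not_preservesClass (fun e f => (hD e f).1) hf hf₁
  have hne' : f ≠ f₁ := fun h => hne (by rw [h])
  have h₁ : idemClass (θ e) = idemClass (θ f₁ᶜ) := by
    rw [h, hc, hc, hflip]
  have hff₁ : idemClass fᶜᶜ = idemClass f₁ᶜᶜ := by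
    rw [Idem.compl_compl_eq, Idem.compl_compl_eq, hf₁]
  have finish : idemClass eᶜ = idemClass fᶜᶜ → False := fun hL => by
    have e1 := alone _ hL h
    have e2 := alone _ (hL.trans hff₁) h₁
    apply hne'
    rw [← f.compl_compl_eq, ← e1, e2, f₁.compl_compl_eq]
  -- The idempotents `fᶜ` and `f₁ᶜ` are distinct and left equivalent, so `e` cannot be right
  -- equivalent to both. If `e` is left equivalent to one, it is to both, and `alone` identifies all
  -- three.
  rcases (hD e fᶜ).2 (Or.inl h) with h3 | h3
  · rcases (hD e f₁ᶜ).2 (Or.inl h₁) with h4 | h4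
    · have := Idem.eq_of_idemClass_eq (h3.symm.trans h4) hff₁
      apply hne'
      rw [← f.compl_compl_eq, this, f₁.compl_compl_eq]
    · exact finish (h4.trans hff₁.symm)
  · exact finish h3

open Classical in
/-- The map of classes which sends `[e]` to `[θ(e)]` if the class of `e` is preserved and to
`[θ(1 - e)]` otherwise. -/
noncomputable def classMap (θ : Idem R → Idem S) (c : IdemClass R) : IdemClass S :=
  if PreservesClass θ c.out then idemClass (θ c.out) else idemClass (θ c.outᶜ)

theorem classMap_of_preservesClass {θ : Idem R → Idem S} {e : Idem R} (h : PreservesClass θ e) :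
    classMap θ (idemClass e) = idemClass (θ e) := by
  have h' : idemClass (idemClass e).out = idemClass e := Quotient.out_eq _
  rw [classMap, if_pos (h.congr h'.symm), ← h _ h'.symm]

theorem classMap_of_not_preservesClass {θ : Idem R → Idem S} {e : Idem R}
    (hD : ∀ e f, idemClass e = idemClass f ∨ idemClass eᶜ = idemClass fᶜ →
      idemClass (θ e) = idemClass (θ f) ∨ idemClass (θ e)ᶜ = idemClass (θ f)ᶜ)
    (hc : ∀ e, θ eᶜ = (θ e)ᶜ) (h : ¬ PreservesClass θ e) :
    classMap θ (idemClass e) = idemClass (θ eᶜ) := by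
  have h' : idemClass (idemClass e).out = idemClass e := Quotient.out_eq _
  rw [classMap, if_neg fun hp => h (hp.congr h'), hc, hc,
    idemClass_compl_eq_of_not_preservesClass hD h h'.symm]

theorem classMap_bijective {θ : Idem R ≃ Idem S}
    (hD : ∀ e f, idemClass e = idemClass f ∨ idemClass eᶜ = idemClass fᶜ ↔
      idemClass (θ e) = idemClass (θ f) ∨ idemClass (θ e)ᶜ = idemClass (θ f)ᶜ)
    (hc : ∀ e, θ eᶜ = (θ e)ᶜ)
    (hsub : ∀ e : Idem R, (∀ f : Idem R, idemClass e = idemClass f → e = f) → e = 0 ∨ e = 1) :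
    Function.Bijective (classMap θ) := by
  have hneg : ∀ {e : Idem R}, ¬ PreservesClass θ e →
      classMap θ (idemClass e) = idemClass (θ eᶜ) :=
    classMap_of_not_preservesClass (fun e f => (hD e f).1) hc
  constructor
  · intro c d
    obtain ⟨e, rfl⟩ : ∃ e, idemClass e = c := Quotient.exists_rep c
    obtain ⟨f, rfl⟩ : ∃ f, idemClass f = d := Quotient.exists_rep d
    intro h
    by_cases he : PreservesClass θ e <;> by_cases hf : PreservesClass θ f
    · rw [classMap_of_preservesClass he, classMap_of_preservesClass hf] at h
      rcases (hD e f).2 (Or.inl h) with h1 | h1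
      · exact h1
      · rw [he.eq_of_idemClass_compl_eq (fun e f => (hD e f).2) hsub h1 h]
    · rw [classMap_of_preservesClass he, hneg hf] at h
      exact absurd h (he.idemClass_ne_compl hD hc hsub hf)
    · rw [classMap_of_preservesClass hf, hneg he] at h
      exact absurd h.symm (hf.idemClass_ne_compl hD hc hsub he)
    · rw [hneg he, hneg hf, hc, hc] at h
      rcases (hD e f).2 (Or.inr h) with h1 | h1
      · exact h1
      have he' := he
      simp only [PreservesClass, not_forall] at he'
      obtain ⟨e', h2, h3⟩ := he'
      have h4 := idemClass_compl_eq_of_not_preservesClass (fun e f => (hD e f).1) he h2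
      rcases (hD e' f).2 (Or.inr (h4.symm.trans h)) with h5 | h5
      · exact h2.trans h5
      · exact absurd (by rw [Idem.eq_of_idemClass_eq h2 (h1.trans h5.symm)]) h3
  · intro d
    obtain ⟨g, rfl⟩ : ∃ g, idemClass g = d := Quotient.exists_rep d
    obtain ⟨e, rfl⟩ := θ.surjective g
    by_cases he : PreservesClass θ e
    · exact ⟨_, classMap_of_preservesClass he⟩
    -- If the class of `e` is reversed, so is that of `eᶜ`; the preimage is thus the class of the
    -- complement.
    · refine ⟨idemClass eᶜ, ?_⟩
      have : ¬ PreservesClass θ eᶜ := fun h => h.idemClass_ne_compl hD hc hsub he rfl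
      rw [hneg this, e.compl_compl_eq]

end ClassMap

/-! ### Compatibility with complements -/

theorem PrimeRing.eq_one_or_eq_neg_one {R : Type*} [Ring R] (hp : PrimeRing R) {z : R}
    (hz : ∀ y, z * y = y * z) (hzz : z * z = 1) : z = 1 ∨ z = -1 := by
  have key : ∀ y, (z - 1) * y * (z + 1) = 0 := fun y => by
    linear_combination (norm := noncomm_ring) (hz y) * z + y * hzz + hz y
  rcases hp (z - 1) (z + 1) key with h | h
  · exact Or.inl (sub_eq_zero.1 h)
  · exact Or.inr (eq_neg_of_add_eq_zero_left h)

theorem Idem.compl_zero_eq (R : Type*) [Ring R] : (0 : Idem R)ᶜ = 1 :=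
  Subtype.ext (sub_zero _)

theorem Idem.toInvolution_zero (R : Type*) [Ring R] :
    ((0 : Idem R).toInvolution : Rˣ) = 1 :=
  Units.ext (by change 1 - 2 * (0 : R) = 1; rw [mul_zero, sub_zero])

theorem Idem.toInvolution_compl {R : Type*} [Ring R] (f : Idem R) :
    (fᶜ.toInvolution : Rˣ) = -1 * (f.toInvolution : Rˣ) :=
  Units.ext (by
    change 1 - 2 * (1 - f.1) = -1 * (1 - 2 * f.1)
    noncomm_ring)

/-- The image of `-1` commutes with all units, hence with everything, so it is a central involution
and equals `±1`. The value `1` would force `2 = 0` in `R`, and then both unit groups are trivial. -/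
theorem map_neg_one_of_primeRing {R S : Type*} [Ring R] [Ring S] (hS : PrimeRing S)
    (ha : UnitAbundant S) (h2 : IsUnit (2 : R)) (φ : Rˣ ≃* Sˣ) : φ (-1) = -1 := by
  have hsq : (φ (-1) : S) * (φ (-1) : S) = 1 := by
    rw [← Units.val_mul, ← map_mul, neg_one_mul, neg_neg, map_one, Units.val_one]
  have hcomm : ∀ y : S, (φ (-1) : S) * y = y * (φ (-1) : S) := fun y => by
    obtain ⟨c, hc, k, hk⟩ := ha y
    obtain ⟨k, rfl⟩ := φ.surjective k
    have h1 : (φ (-1) : S) * (φ k : S) = (φ k : S) * (φ (-1) : S) := by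
      rw [← Units.val_mul, ← Units.val_mul, ← map_mul, ← map_mul, neg_one_mul, mul_neg_one]
    rw [hk] at h1
    linear_combination (norm := noncomm_ring) h1 + hc (φ (-1) : S)
  rcases hS.eq_one_or_eq_neg_one hcomm hsq with h | h
  · have h1 : φ (-1) = 1 := Units.ext h
    have h3 : (-1 : Rˣ) = 1 := (EmbeddingLike.map_eq_one_iff (f := φ)).1 h1
    have h4 : (2 : R) = 0 := by
      have h5 : (-1 : R) = 1 := congrArg Units.val h3
      calc (2 : R) = 1 + 1 := one_add_one_eq_two.symm
        _ = 1 + -1 := by rw [h5]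
        _ = 0 := add_neg_cancel 1
    rw [h4, isUnit_zero_iff] at h2
    have : Subsingleton R := subsingleton_of_zero_eq_one h2
    have hsub : Subsingleton Sˣ := φ.symm.toEquiv.subsingleton
    exact Subsingleton.elim _ _
  · exact Units.ext h

/-! ### Application to the induced bijection -/

section Induced

variable {H K : Type*} [NormedAddCommGroup H] [InnerProductSpace ℂ H] [CompleteSpace H]
  [NormedAddCommGroup K] [InnerProductSpace ℂ K] [CompleteSpace K]
  {N : VonNeumannAlgebra H} {M : VonNeumannAlgebra K}

theorem toInvolution_inducedIdemEquiv (φ : (N : Type _)ˣ ≃* (M : Type _)ˣ) (e : Idem N) :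
    ((inducedIdemEquiv φ e).toInvolution : (M : Type _)ˣ)
      = φ (e.toInvolution : (N : Type _)ˣ) :=
  Units.ext (one_sub_two_mul_inducedIdemEquiv φ e)

theorem inducedIdemEquiv_compl (hM : M.IsFactor) (φ : (N : Type _)ˣ ≃* (M : Type _)ˣ)
    (e : Idem N) : inducedIdemEquiv φ eᶜ = (inducedIdemEquiv φ e)ᶜ := by
  apply (Idem.toInvolution_bijective M.isUnit_two).1
  apply Subtype.ext
  rw [Idem.toInvolution_compl, toInvolution_inducedIdemEquiv, toInvolution_inducedIdemEquiv,
    Idem.toInvolution_compl, map_mul, map_neg_one_of_primeRing hM.primeRing M.unitAbundant N.isUnit_two φ]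

theorem inducedIdemEquiv_zero (φ : (N : Type _)ˣ ≃* (M : Type _)ˣ) :
    inducedIdemEquiv φ 0 = 0 := by
  apply (Idem.toInvolution_bijective M.isUnit_two).1
  apply Subtype.ext
  rw [toInvolution_inducedIdemEquiv, Idem.toInvolution_zero, Idem.toInvolution_zero, map_one]

theorem inducedIdemEquiv_one (hM : M.IsFactor) (φ : (N : Type _)ˣ ≃* (M : Type _)ˣ) :
    inducedIdemEquiv φ 1 = 1 := by
  have h2 := inducedIdemEquiv_compl hM φ 0
  rw [inducedIdemEquiv_zero, Idem.compl_zero_eq, Idem.compl_zero_eq] at h2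
  exact h2

theorem inducedIdemEquiv_sameIdeal_iff (hN : N.IsFactor) (hM : M.IsFactor)
    (φ : (N : Type _)ˣ ≃* (M : Type _)ˣ) (e f : Idem N) :
    idemClass e = idemClass f ∨ idemClass eᶜ = idemClass fᶜ ↔
      idemClass (inducedIdemEquiv φ e) = idemClass (inducedIdemEquiv φ f) ∨
        idemClass (inducedIdemEquiv φ e)ᶜ = idemClass (inducedIdemEquiv φ f)ᶜ := by
  by_cases hef : e = f
  · subst hef
    exact iff_of_true (Or.inl rfl) (Or.inl rfl)
  · rw [← Idem.squareConjugate_iff hN.primeRing N.unitAbundant N.isUnit_two N.isUnit_three hef,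
      ← Idem.squareConjugate_iff hM.primeRing M.unitAbundant M.isUnit_two M.isUnit_three
        ((inducedIdemEquiv φ).injective.ne hef),
      toInvolution_inducedIdemEquiv, toInvolution_inducedIdemEquiv, squareConjugate_map_iff]

end Induced

theorem theoremD {H K : Type*}
    [NormedAddCommGroup H] [InnerProductSpace ℂ H] [CompleteSpace H]
    [NormedAddCommGroup K] [InnerProductSpace ℂ K] [CompleteSpace K]
    (N : VonNeumannAlgebra H) (M : VonNeumannAlgebra K)
    (hN : N.IsFactor) (hM : M.IsFactor)
    (φ : (N : Type _)ˣ ≃* (M : Type _)ˣ) :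
    ∃ Io Io' : Set (IdemClass N),
      Io ∪ Io' = {c | c ≠ idemClass (0 : Idem N) ∧ c ≠ idemClass (1 : Idem N)} ∧
      Disjoint Io Io' ∧
      ∃ Θ : IdemClass N → IdemClass M,
        (∀ e : Idem N, idemClass e ∈ Io →
          Θ (idemClass e) = idemClass (inducedIdemEquiv φ e)) ∧
        (∀ e : Idem N, idemClass e ∈ Io' →
          Θ (idemClass e) = idemClass (inducedIdemEquiv φ eᶜ)) ∧
        Θ (idemClass (1 : Idem N)) = idemClass (1 : Idem M) ∧
        Θ (idemClass (0 : Idem N)) = idemClass (0 : Idem M) ∧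
        Function.Bijective Θ := by
  have hD := inducedIdemEquiv_sameIdeal_iff hN hM φ
  have hc := inducedIdemEquiv_compl hM φ
  let T : Set (IdemClass N) := {c | c ≠ idemClass 0 ∧ c ≠ idemClass 1}
  let P : Set (IdemClass N) := {c | PreservesClass (inducedIdemEquiv φ) c.out}
  have hout : ∀ e : Idem N, idemClass (idemClass e).out = idemClass e := fun e =>
    Quotient.out_eq _
  refine ⟨T ∩ P, T \ P, Set.inter_union_sdiff T P, Set.disjoint_sdiff_inter.symm,
    classMap (inducedIdemEquiv φ), fun e he => ?_, fun e he => ?_, ?_, ?_,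
    classMap_bijective hD hc hN.primeRing.eq_zero_or_one_of_class_subsingleton⟩
  · exact classMap_of_preservesClass (PreservesClass.congr he.2 (hout e))
  · exact classMap_of_not_preservesClass (fun e f => (hD e f).1) hc
      fun h => he.2 (h.congr (hout e).symm)
  -- The classes of `1` and `0` are singletons, so they are preserved automatically.
  · rw [classMap_of_preservesClass, inducedIdemEquiv_one hM]
    intro f hf
    rw [idemClass_eq_one_iff.1 hf.symm]
  · rw [classMap_of_preservesClass, inducedIdemEquiv_zero]
    intro f hf
    rw [idemClass_eq_zero_iff.1 hf.symm]
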